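/- **Conventions.** $\lambda\in\mathbb N$ is the security parameter; a function $\nu:\mathbb N\to\mathbb R$ is negligible if $\lambda^c\nu(\lambda)\to 0$ for every $c\in\mathbb N$. Adversaries and distinguishers are non-uniform quantum polynomial-time, i.e. families, indexed by $\lambda$, of polynomial-size general quantum circuits (over $X$, Hadamard, $T$, CNOT, Toffoli, fresh qubits in state $|0\rangle$, and tracing out of qubits). Quantum algorithms of a scheme are likewise given by polynomial-size quantum circuits, and classical polynomial-time algorithms by polynomial-size Boolean circuits with uniformly random coins. **Uncloneable security.** Let $S=(\mathsf{Setup},\mathsf{Enc},\mathsf{Dec})$ be a scheme with classical keys $k\leftarrow\mathsf{Setup}(1^\lambda)$ that encrypts messages $m\in\{0,1\}^{n}$, $n=n(\lambda)$, into quantum states $\mathsf{Enc}(k,m)$. In the cloning experiment against an adversary $(\mathcal A,\mathcal B,\mathcal C)$, the challenger samples $k\leftarrow\mathsf{Setup}(1^\lambda)$ and a uniformly random $m\in\{0,1\}^n$ and gives $\mathsf{Enc}(k,m)$ to $\mathcal A$, who maps it to a state of two registers $B,C$. Then $\mathcal B$ receives $k$ and register $B$, and $\mathcal C$ receives $k$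 and register $C$; without communicating they output $m_B$ and $m_C$, and win if $m_B=m_C=m$. For $t:\mathbb N\to\mathbb R$, $S$ is *$t$-uncloneable secure* if for every quantum polynomial-time adversary there is a negligible $\nu$ such that for all $\lambda$ the winning probability is at most $2^{-n(\lambda)+t(\lambda)}+\nu(\lambda)$. **Fake-key property.** A classical private-key encryption scheme $\mathsf{PKE}$ has the fake-key property if there is a classical probabilistic polynomial-time algorithm $\mathsf{FakeGen}$ which, given a ciphertext and a message, outputs a key, such that for every sequence of messages $m=m_\lambda$ the distributions $$\{(\mathsf{Enc}(k,m),\,k)\}\quad\text{and}\quad\{(ct^0,\ \mathsf{FakeGen}(ct^0,m)) : ct^0\leftarrow\mathsf{Enc}(k,0)\},\qquad k\leftarrow\mathsf{Setup}(1^\lambda),$$ are computationally indistinguishable, where $0$ is the all-zero message: every quantum polynomial-time distinguisher has negligible advantage. **Theorem.** Let $\mathsf{UE}$ be a quantum polynomial-time encryption scheme of classical messages with classical keys in $\{0,1\}^{\kappa(\lambda)}$, and let $\mathsf{PKE}$ be a classical probabilistic polynomial-time private-key encryption scheme with message space $\{0,1\}^{\kappa(\lambda)}$ and the fake-key property. Consider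 the scheme with * $\mathsf{Setup}(1^\lambda)$: output $k_{\mathsf{PKE}}\leftarrow\mathsf{PKE.Setup}(1^\lambda)$; * $\mathsf{Enc}(k_{\mathsf{PKE}},m)$: sample $k_{\mathsf{UE}}\leftarrow\mathsf{UE.Setup}(1^\lambda)$ and output $(ct_1,ct_2)$ with $ct_1\leftarrow\mathsf{PKE.Enc}(k_{\mathsf{PKE}},k_{\mathsf{UE}})$ and $ct_2\leftarrow\mathsf{UE.Enc}(k_{\mathsf{UE}},m)$; * $\mathsf{Dec}(k_{\mathsf{PKE}},(ct_1,ct_2))$: output $\mathsf{UE.Dec}(\mathsf{PKE.Dec}(k_{\mathsf{PKE}},ct_1),ct_2)$. For every $t:\mathbb N\to\mathbb R$, if $\mathsf{UE}$ is $t$-uncloneable secure, then this scheme is also $t$-uncloneable secure. -/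

import Mathlib

noncomputable section

namespace Uncloneable

/-! ### Registers, states and channels -/

/-- Bit assignments to a set `α` of wires. -/
abbrev Bits (α : Type) : Type := α → Bool

/-- Operators on the Hilbert space of a register of qubits labelled by `α`,
written as matrices in the computational basis. -/
abbrev Op (α : Type) : Type := Matrix (Bits α) (Bits α) ℂ

open Classical in
/-- The classical distribution `p`, as a density operator that is diagonal in the
computational basis. -/
def classicalState {α : Type} (p : PMF (Bits α)) : Op α :=
  Matrix.diagonal fun x => ((p x).toReal : ℂ)

/-- The basis state `|x⟩⟨x|`. -/
def ket {α : Type} (x : Bits α) : Op α := classicalState (PMF.pure x)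

/-- The product operator `ρ ⊗ σ`. -/
def tensorOp {α β : Type} (ρ : Op α) (σ : Op β) : Op (α ⊕ β) :=
  Matrix.of fun x y => ρ (x ∘ Sum.inl) (y ∘ Sum.inl) * σ (x ∘ Sum.inr) (y ∘ Sum.inr)

/-- `ρ ↦ ρ₀ ⊗ ρ` for a fixed `ρ₀`. -/
def prepend {α β : Type} (ρ₀ : Op α) : Op β →ₗ[ℂ] Op (α ⊕ β) where
  toFun ρ := tensorOp ρ₀ ρ
  map_add' ρ σ := by ext x y; simp [tensorOp, mul_add]
  map_smul' c ρ := by ext x y; simp [tensorOp, mul_left_comm]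

/-- `Φ ⊗ id`, computed block by block. -/
def onLeft {α β : Type} (γ : Type) (Φ : Op α →ₗ[ℂ] Op β) : Op (α ⊕ γ) →ₗ[ℂ] Op (β ⊕ γ) where
  toFun X := Matrix.of fun y y' =>
    Φ (Matrix.of fun a a' => X (Sum.elim a (y ∘ Sum.inr)) (Sum.elim a' (y' ∘ Sum.inr)))
      (y ∘ Sum.inl) (y' ∘ Sum.inl)
  map_add' X Y := by
    ext y y'
    simp only [Matrix.of_apply, Matrix.add_apply]
    rw [← Matrix.add_apply, ← map_add]
    rfl
  map_smul' c X := by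
    ext y y'
    simp only [Matrix.of_apply, Matrix.smul_apply, RingHom.id_apply]
    rw [← Matrix.smul_apply, ← map_smul]
    rfl

/-- `id ⊗ Ψ`, computed block by block. -/
def onRight {γ δ : Type} (α : Type) (Ψ : Op γ →ₗ[ℂ] Op δ) : Op (α ⊕ γ) →ₗ[ℂ] Op (α ⊕ δ) where
  toFun X := Matrix.of fun y y' =>
    Ψ (Matrix.of fun c c' => X (Sum.elim (y ∘ Sum.inl) c) (Sum.elim (y' ∘ Sum.inl) c'))
      (y ∘ Sum.inr) (y' ∘ Sum.inr)
  map_add' X Y := by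
    ext y y'
    simp only [Matrix.of_apply, Matrix.add_apply]
    rw [← Matrix.add_apply, ← map_add]
    rfl
  map_smul' c X := by
    ext y y'
    simp only [Matrix.of_apply, Matrix.smul_apply, RingHom.id_apply]
    rw [← Matrix.smul_apply, ← map_smul]
    rfl

/-- `Φ ⊗ Ψ`. -/
def tensorMap {α β γ δ : Type} (Φ : Op α →ₗ[ℂ] Op β) (Ψ : Op γ →ₗ[ℂ] Op δ) :
    Op (α ⊕ γ) →ₗ[ℂ] Op (β ⊕ δ) :=
  onRight β Ψ ∘ₗ onLeft γ Φ

/-- `X ↦ (⟨c| ⊗ 1) X (|c⟩ ⊗ 1)`: the unnormalized state of the second register when the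
first one is measured with outcome `c`. -/
def block {α β : Type} (c : Bits α) : Op (α ⊕ β) →ₗ[ℂ] Op β where
  toFun X := Matrix.of fun y y' => X (Sum.elim c y) (Sum.elim c y')
  map_add' _ _ := rfl
  map_smul' _ _ := rfl

/-- Probability of the outcome `x` when `ρ` is measured in the computational basis. -/
def outcomeProb {α : Type} (ρ : Op α) (x : Bits α) : ℝ := (ρ x x).re

/-! ### Circuits -/

/-- Circuits over a gate set `G` (`G k l` are the gates with `k` inputs and `l` outputs), with
input wires `α` and output wires `β`. -/
inductive Circ (G : ℕ → ℕ → Type) : Type → Type → Type 1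
  | wires {α β : Type} (h : Finite α) (e : α ≃ β) : Circ G α β
  | gate {k l : ℕ} (g : G k l) : Circ G (Fin k) (Fin l)
  | seq {α β γ : Type} (c : Circ G α β) (d : Circ G β γ) : Circ G α γ
  | par {α β γ δ : Type} (c : Circ G α β) (d : Circ G γ δ) : Circ G (α ⊕ γ) (β ⊕ δ)

/-- Number of gates, plus the number of wires in every bundle of plain wires. -/
def Circ.size {G : ℕ → ℕ → Type} : {α β : Type} → Circ G α β → ℕ
  | α, _, .wires _ _ => Nat.card α
  | _, _, .gate _ => 1
  | _, _, .seq c d => c.size + d.size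
  | _, _, .par c d => c.size + d.size

/-- The family of circuits has polynomial size in the security parameter. -/
def PolySize {G : ℕ → ℕ → Type} {α β : ℕ → Type} (C : ∀ l, Circ G (α l) (β l)) : Prop :=
  ∃ p : Polynomial ℕ, ∀ l, (C l).size ≤ p.eval l

/-- Gates of Boolean circuits. -/
inductive CGate : ℕ → ℕ → Type
  | const (b : Bool) : CGate 0 1
  | copy : CGate 1 2
  | nand : CGate 2 1
  | discard : CGate 1 0

def CGate.eval : {k l : ℕ} → CGate k l → Bits (Fin k) → Bits (Fin l)
  | _, _, .const b, _ => ![b]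
  | _, _, .copy, x => ![x 0, x 0]
  | _, _, .nand, x => ![!(x 0 && x 1)]
  | _, _, .discard, _ => ![]

/-- Boolean circuits. -/
abbrev CCirc : Type → Type → Type 1 := Circ CGate

/-- The Boolean function computed by a Boolean circuit. -/
def CCirc.eval : {α β : Type} → CCirc α β → Bits α → Bits β
  | _, _, .wires _ e, x => x ∘ e.symm
  | _, _, .gate g, x => g.eval x
  | _, _, .seq c d, x => CCirc.eval d (CCirc.eval c x)
  | _, _, .par c d, x =>
      Sum.elim (CCirc.eval c (x ∘ Sum.inl)) (CCirc.eval d (x ∘ Sum.inr))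

/-- Gates of general quantum circuits: the unitary gates `X`, Hadamard, `T`, controlled-not and
Toffoli, a fresh qubit in state `|0⟩`, and tracing out a qubit. -/
inductive QGate : ℕ → ℕ → Type
  | not : QGate 1 1
  | hadamard : QGate 1 1
  | tphase : QGate 1 1
  | cnot : QGate 2 2
  | toffoli : QGate 3 3
  | init : QGate 0 1
  | discard : QGate 1 0

/-- The matrix sending `|x⟩` to `|f x⟩`. -/
def basisMatrix {k l : ℕ} (f : Bits (Fin k) → Bits (Fin l)) :
    Matrix (Bits (Fin l)) (Bits (Fin k)) ℂ :=
  Matrix.of fun y x => if y = f x then 1 else 0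

def hadamardMatrix : Matrix (Bits (Fin 1)) (Bits (Fin 1)) ℂ :=
  Matrix.of fun y x => (if x 0 && y 0 then -1 else 1) / (Real.sqrt 2 : ℂ)

def tMatrix : Matrix (Bits (Fin 1)) (Bits (Fin 1)) ℂ :=
  Matrix.diagonal fun x => if x 0 then Complex.exp (Real.pi / 4 * Complex.I) else 1

/-- `ρ ↦ U ρ U†`. -/
def conj {k l : ℕ} (U : Matrix (Bits (Fin l)) (Bits (Fin k)) ℂ) :
    Op (Fin k) →ₗ[ℂ] Op (Fin l) where
  toFun ρ := U * ρ * U.conjTranspose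
  map_add' ρ σ := by rw [Matrix.mul_add, Matrix.add_mul]
  map_smul' c ρ := by simp

def traceOut : Op (Fin 1) →ₗ[ℂ] Op (Fin 0) where
  toFun ρ := Matrix.of fun _ _ => ρ.trace
  map_add' ρ σ := by ext; simp
  map_smul' c ρ := by ext; simp

def QGate.eval : {k l : ℕ} → QGate k l → Op (Fin k) →ₗ[ℂ] Op (Fin l)
  | _, _, .not => conj (basisMatrix fun x => ![!x 0])
  | _, _, .hadamard => conj hadamardMatrix
  | _, _, .tphase => conj tMatrix
  | _, _, .cnot => conj (basisMatrix fun x => ![x 0, xor (x 0) (x 1)])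
  | _, _, .toffoli => conj (basisMatrix fun x => ![x 0, x 1, xor (x 2) (x 0 && x 1)])
  | _, _, .init => conj (basisMatrix fun _ => ![false])
  | _, _, .discard => traceOut

/-- General quantum circuits. -/
abbrev QCirc : Type → Type → Type 1 := Circ QGate

/-- `ρ` with its wires renamed along `e`. -/
def relabel {α β : Type} (e : α ≃ β) : Op α →ₗ[ℂ] Op β where
  toFun ρ := Matrix.of fun y y' => ρ (y ∘ e) (y' ∘ e)
  map_add' _ _ := rfl
  map_smul' _ _ := rfl

/-- The channel implemented by a quantum circuit. -/
def QCirc.eval : {α β : Type} → QCirc α β → Op α →ₗ[ℂ] Op β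
  | _, _, .wires _ e => relabel e
  | _, _, .gate g => g.eval
  | _, _, .seq c d => QCirc.eval d ∘ₗ QCirc.eval c
  | _, _, .par c d => tensorMap (QCirc.eval c) (QCirc.eval d)

/-! ### Efficiency and computational indistinguishability -/

/-- Negligible functions of the security parameter. -/
def Negligible (ν : ℕ → ℝ) : Prop :=
  Asymptotics.SuperpolynomialDecay Filter.atTop (fun l : ℕ => (l : ℝ)) ν

/-- The randomized classical map `f` is computed by Boolean circuits of polynomial size that
are given uniformly random coins. -/
def IsPPT {α β : ℕ → Type} (f : ∀ l, Bits (α l) → PMF (Bits (β l))) : Prop :=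
  ∃ (r : ℕ → ℕ) (C : ∀ l, CCirc (α l ⊕ Fin (r l)) (β l)), PolySize C ∧
    ∀ l x, f l x =
      (PMF.uniformOfFintype (Bits (Fin (r l)))).map fun c => CCirc.eval (C l) (Sum.elim x c)

/-- Probability that the distinguisher `D` outputs `1` on a sample from `p`. -/
def acceptProb {α : Type} (D : QCirc α (Fin 1)) (p : PMF (Bits α)) : ℝ :=
  outcomeProb (QCirc.eval D (classicalState p)) fun _ => true

/-- Computational indistinguishability against quantum circuits of polynomial size. -/
def CompIndist {α : ℕ → Type} (p q : ∀ l, PMF (Bits (α l))) : Prop :=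
  ∀ D : ∀ l, QCirc (α l) (Fin 1), PolySize D →
    Negligible fun l => |acceptProb (D l) (p l) - acceptProb (D l) (q l)|

/-! ### Classical private-key encryption with the fake-key property -/

/-- A classical private-key encryption scheme for messages in `{0,1}^(msgLen l)`, where `l` is
the security parameter. -/
structure PrivKeyEnc (msgLen : ℕ → ℕ) where
  keyLen : ℕ → ℕ
  ctLen : ℕ → ℕ
  setup : ∀ l, PMF (Bits (Fin (keyLen l)))
  enc : ∀ l, Bits (Fin (keyLen l)) → Bits (Fin (msgLen l)) → PMF (Bits (Fin (ctLen l)))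
  dec : ∀ l, Bits (Fin (keyLen l)) → Bits (Fin (ctLen l)) → Bits (Fin (msgLen l))

namespace PrivKeyEnc

variable {msgLen : ℕ → ℕ} (P : PrivKeyEnc msgLen)

/-- The three algorithms run in polynomial time. -/
def Efficient : Prop :=
  IsPPT (α := fun _ => Empty) (fun l _ => P.setup l) ∧
  IsPPT (α := fun l => Fin (P.keyLen l) ⊕ Fin (msgLen l))
    (fun l x => P.enc l (x ∘ Sum.inl) (x ∘ Sum.inr)) ∧
  IsPPT (α := fun l => Fin (P.keyLen l) ⊕ Fin (P.ctLen l))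
    (fun l x => PMF.pure (P.dec l (x ∘ Sum.inl) (x ∘ Sum.inr)))

/-- `(Enc(k, m), k)` for `k ← Setup`. -/
def realPair (l : ℕ) (m : Bits (Fin (msgLen l))) :
    PMF (Bits (Fin (P.ctLen l) ⊕ Fin (P.keyLen l))) :=
  (P.setup l).bind fun k => (P.enc l k m).bind fun c => PMF.pure (Sum.elim c k)

/-- `(ct⁰, FakeGen(ct⁰, m))` for `k ← Setup` and `ct⁰ ← Enc(k, 0)`. -/
def fakePair
    (fakeGen : ∀ l, Bits (Fin (P.ctLen l)) → Bits (Fin (msgLen l)) → PMF (Bits (Fin (P.keyLen l))))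
    (l : ℕ) (m : Bits (Fin (msgLen l))) :
    PMF (Bits (Fin (P.ctLen l) ⊕ Fin (P.keyLen l))) :=
  (P.setup l).bind fun k => (P.enc l k fun _ => false).bind fun c =>
    (fakeGen l c m).bind fun fk => PMF.pure (Sum.elim c fk)

/-- The fake-key property. -/
def FakeKeyProperty : Prop :=
  ∃ fakeGen : ∀ l, Bits (Fin (P.ctLen l)) → Bits (Fin (msgLen l)) →
      PMF (Bits (Fin (P.keyLen l))),
    IsPPT (α := fun l => Fin (P.ctLen l) ⊕ Fin (msgLen l))
      (fun l x => fakeGen l (x ∘ Sum.inl) (x ∘ Sum.inr)) ∧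
    ∀ m : ∀ l, Bits (Fin (msgLen l)),
      CompIndist (fun l => P.realPair l (m l)) (fun l => P.fakePair fakeGen l (m l))

end PrivKeyEnc

/-! ### Quantum encryption of classical messages, cloning experiments -/

/-- A private-key scheme with classical keys that encrypts classical messages in
`{0,1}^(msgLen l)` into states of a quantum register `ct l`. -/
structure QuantumEnc where
  keyLen : ℕ → ℕ
  msgLen : ℕ → ℕ
  ct : ℕ → Type
  ctFinite : ∀ l, Finite (ct l)
  setup : ∀ l, PMF (Bits (Fin (keyLen l)))
  enc : ∀ l, Bits (Fin (keyLen l)) → Bits (Fin (msgLen l)) → Op (ct l)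
  dec : ∀ l, Bits (Fin (keyLen l)) → Op (ct l) →ₗ[ℂ] Op (Fin (msgLen l))

namespace QuantumEnc

variable (S : QuantumEnc)

/-- The three algorithms are implemented by quantum circuits of polynomial size. In particular
every `enc l k m` is a density operator and every `dec l k` a channel. -/
def Efficient : Prop :=
  (∃ C : ∀ l, QCirc Empty (Fin (S.keyLen l)), PolySize C ∧
    ∀ l k, outcomeProb (QCirc.eval (C l) (ket Empty.elim)) k = (S.setup l k).toReal) ∧
  (∃ C : ∀ l, QCirc (Fin (S.keyLen l) ⊕ Fin (S.msgLen l)) (S.ct l), PolySize C ∧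
    ∀ l k m, QCirc.eval (C l) (ket (Sum.elim k m)) = S.enc l k m) ∧
  (∃ C : ∀ l, QCirc (Fin (S.keyLen l) ⊕ S.ct l) (Fin (S.msgLen l)), PolySize C ∧
    ∀ l k ρ, QCirc.eval (C l) (tensorOp (ket k) ρ) = S.dec l k ρ)

/-- Success probability of a cloning adversary at security parameter `l`. A uniformly random
message `m` is encrypted under `k ← Setup`; Alice maps the ciphertext to a state of two registers
`B` and `C`; Bob and Charlie each receive `k` and one register, and win if both output `m`. -/
def cloneProb (l : ℕ) {B C : Type} (alice : QCirc (S.ct l) (B ⊕ C))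
    (bob : QCirc (Fin (S.keyLen l) ⊕ B) (Fin (S.msgLen l)))
    (charlie : QCirc (Fin (S.keyLen l) ⊕ C) (Fin (S.msgLen l))) : ℝ :=
  ∑ m : Bits (Fin (S.msgLen l)), ∑ k : Bits (Fin (S.keyLen l)),
    ((2 : ℝ) ^ S.msgLen l)⁻¹ * (S.setup l k).toReal *
      outcomeProb
        (tensorMap (QCirc.eval bob ∘ₗ prepend (ket k)) (QCirc.eval charlie ∘ₗ prepend (ket k))
          (QCirc.eval alice (S.enc l k m)))
        (Sum.elim m m)

/-- `t`-uncloneable security: every cloning adversary of polynomial size succeeds with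
probability at most `2 ^ (-n + t)` plus a negligible function, where `n` is the message length. -/
def UncloneableSecure (t : ℕ → ℝ) : Prop :=
  ∀ (B C : ℕ → Type) (alice : ∀ l, QCirc (S.ct l) (B l ⊕ C l))
    (bob : ∀ l, QCirc (Fin (S.keyLen l) ⊕ B l) (Fin (S.msgLen l)))
    (charlie : ∀ l, QCirc (Fin (S.keyLen l) ⊕ C l) (Fin (S.msgLen l))),
    PolySize alice → PolySize bob → PolySize charlie →
      ∃ ν : ℕ → ℝ, Negligible ν ∧ ∀ l,
        S.cloneProb l (alice l) (bob l) (charlie l) ≤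
          (2 : ℝ) ^ (-(S.msgLen l : ℝ) + t l) + ν l

end QuantumEnc

/-- The reusable scheme. `Setup` is that of `P`. `Enc(k, m)` samples `k' ← UE.Setup` and outputs
`(P.Enc(k, k'), UE.Enc(k', m))`. `Dec(k, (ct₁, ct₂))` outputs `UE.Dec(P.Dec(k, ct₁), ct₂)`. -/
def reusableScheme (UE : QuantumEnc) (P : PrivKeyEnc UE.keyLen) : QuantumEnc where
  keyLen := P.keyLen
  msgLen := UE.msgLen
  ct l := Fin (P.ctLen l) ⊕ UE.ct l
  ctFinite l := by
    have := UE.ctFinite l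
    infer_instance
  setup := P.setup
  enc l k m := ∑ k' : Bits (Fin (UE.keyLen l)),
    ((UE.setup l k').toReal : ℂ) •
      tensorOp (classicalState (P.enc l k k')) (UE.enc l k' m)
  dec l k := ∑ c : Bits (Fin (P.ctLen l)), UE.dec l (P.dec l k c) ∘ₗ block c

end Uncloneable

end

noncomputable section

namespace Uncloneable

/-! ### Basis states, products and linear maps -/

section Operators

variable {α β γ δ : Type}

/-! The proof is one hybrid step followed by a reduction. Write k' for the key of the underlying
scheme. In the experiment against the composed scheme, replace (ct₁, k) by (ct⁰, FakeGen(ct⁰, k')).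
For fixed k' and m, the winning probability is the acceptance probability, on this pair, of a
circuit that prepares UE.Enc(k', m), copies the classical key, runs the three adversaries and
compares both outputs with m (`exists_distinguisher`, `cloneProb_reusableScheme`). The fake-key
property concerns one sequence of messages at a time, so the pair (k', m) with the largest gap is
hardwired at each security parameter; that negligible gap then bounds the change for all (k', m)
simultaneously.

After the replacement, ct⁰ and the coins of FakeGen are independent of k' and m, so some fixed
values do at least as well as the average. With these hardwired, Alice supplies ct⁰ herself, while
Bob and Charlie, who receive k', compute the same fake key without communicating because they use
the same fixed coins (`exists_adversary`). This is an attack on the underlying scheme, so the loss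
is only the additive gap and t is unchanged.

The remaining work is to realise these adversaries as circuits. Boolean circuits are simulated by
quantum ones (`CCirc.exists_qCirc`), and all overheads are polynomial because circuit size controls
the number of input wires. -/

open Classical in
theorem ket_apply (x y y' : Bits α) : ket x y y' = if y = x ∧ y' = x then 1 else 0 := by
  unfold ket classicalState
  rw [Matrix.diagonal_apply, PMF.pure_apply]
  by_cases h : y = x <;> by_cases h' : y' = x <;> by_cases h'' : y = y' <;> simp_all

theorem sumElim_eq_iff (x : Bits (α ⊕ β)) (a : Bits α) (b : Bits β) :
    x = Sum.elim a b ↔ x ∘ Sum.inl = a ∧ x ∘ Sum.inr = b := by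
  constructor
  · rintro rfl
    simp
  · rintro ⟨rfl, rfl⟩
    exact (Sum.elim_comp_inl_inr x).symm

theorem tensorOp_ket (x : Bits α) (y : Bits β) :
    tensorOp (ket x) (ket y) = ket (Sum.elim x y) := by
  ext a b
  have ha := sumElim_eq_iff a x y
  have hb := sumElim_eq_iff b x y
  simp only [tensorOp, Matrix.of_apply, ket_apply]
  by_cases h : a = Sum.elim x y ∧ b = Sum.elim x y
  · have := ha.1 h.1
    have := hb.1 h.2
    rw [if_pos h, if_pos (by tauto), if_pos (by tauto), one_mul]
  · rw [if_neg h, ite_zero_mul, one_mul, ← ite_and, if_neg]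
    tauto

theorem tensorOp_sum_left {ι : Type} (s : Finset ι) (ρ : ι → Op α) (σ : Op β) :
    tensorOp (∑ i ∈ s, ρ i) σ = ∑ i ∈ s, tensorOp (ρ i) σ := by
  ext x y
  simp [tensorOp, Matrix.sum_apply, Finset.sum_mul]

theorem tensorOp_smul_left (c : ℂ) (ρ : Op α) (σ : Op β) :
    tensorOp (c • ρ) σ = c • tensorOp ρ σ := by
  ext x y
  simp [tensorOp, mul_assoc]

theorem onLeft_tensorOp (Φ : Op α →ₗ[ℂ] Op β) (ρ : Op α) (σ : Op γ) :
    onLeft γ Φ (tensorOp ρ σ) = tensorOp (Φ ρ) σ := by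
  ext y y'
  have h : (Matrix.of fun a a' => tensorOp ρ σ (Sum.elim a (y ∘ Sum.inr))
      (Sum.elim a' (y' ∘ Sum.inr)) : Op α) = σ (y ∘ Sum.inr) (y' ∘ Sum.inr) • ρ := by
    ext a a'
    simp [tensorOp, mul_comm]
  simp only [onLeft, LinearMap.coe_mk, AddHom.coe_mk, Matrix.of_apply, h, map_smul]
  simp [tensorOp, mul_comm]

theorem onRight_tensorOp (Ψ : Op γ →ₗ[ℂ] Op δ) (ρ : Op α) (σ : Op γ) :
    onRight α Ψ (tensorOp ρ σ) = tensorOp ρ (Ψ σ) := by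
  ext y y'
  have h : (Matrix.of fun c c' => tensorOp ρ σ (Sum.elim (y ∘ Sum.inl) c)
      (Sum.elim (y' ∘ Sum.inl) c') : Op γ) = ρ (y ∘ Sum.inl) (y' ∘ Sum.inl) • σ := by
    ext a a'
    simp [tensorOp]
  simp only [onRight, LinearMap.coe_mk, AddHom.coe_mk, Matrix.of_apply, h, map_smul]
  simp [tensorOp]

theorem tensorMap_tensorOp (Φ : Op α →ₗ[ℂ] Op β) (Ψ : Op γ →ₗ[ℂ] Op δ) (ρ : Op α) (σ : Op γ) :
    tensorMap Φ Ψ (tensorOp ρ σ) = tensorOp (Φ ρ) (Ψ σ) := by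
  rw [tensorMap, LinearMap.comp_apply, onLeft_tensorOp, onRight_tensorOp]

/-- Preparing independent registers next to both inputs commutes with a product of maps. -/
theorem tensorMap_comp_prepend {ε ζ : Type} (Φ : Op (ε ⊕ α) →ₗ[ℂ] Op β)
    (Ψ : Op (ζ ⊕ γ) →ₗ[ℂ] Op δ) (ρ : Op ε) (σ : Op ζ) (X : Op (α ⊕ γ)) :
    tensorMap (Φ ∘ₗ prepend ρ) (Ψ ∘ₗ prepend σ) X =
      tensorMap Φ Ψ (tensorMap (prepend ρ) (prepend σ) X) := by
  ext y y'
  simp only [tensorMap, onLeft, onRight, LinearMap.comp_apply, LinearMap.coe_mk, AddHom.coe_mk,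
    Matrix.of_apply]
  refine congrFun (congrFun (congrArg Ψ ?_) _) _
  ext c c'
  simp only [prepend, tensorOp, LinearMap.coe_mk, AddHom.coe_mk, Matrix.of_apply,
    Sum.elim_comp_inl, Sum.elim_comp_inr]
  rw [← smul_eq_mul, ← Matrix.smul_apply, ← map_smul]
  refine congrFun (congrFun (congrArg _ ?_) _) _
  ext a a'
  simp [mul_left_comm]

theorem relabel_ket (e : α ≃ β) (x : Bits α) : relabel e (ket x) = ket (x ∘ e.symm) := by
  ext y y'
  change ket x (y ∘ e) (y' ∘ e) = _
  have h (z : Bits β) : z = x ∘ e.symm ↔ z ∘ e = x := Equiv.eq_comp_symm e z x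
  simp only [ket_apply]
  congr 1
  rw [h, h]

theorem relabel_emptySum_symm (ρ : Op α) :
    relabel (Equiv.emptySum Empty α).symm ρ = tensorOp (ket Empty.elim) ρ := by
  ext y y'
  simp only [tensorOp, Matrix.of_apply, ket_apply]
  rw [if_pos ⟨Subsingleton.elim _ _, Subsingleton.elim _ _⟩, one_mul]
  rfl

theorem relabel_sumEmpty_symm (ρ : Op α) :
    relabel (Equiv.sumEmpty α Empty).symm ρ = tensorOp ρ (ket Empty.elim) := by
  ext y y'
  simp only [tensorOp, Matrix.of_apply, ket_apply]
  rw [if_pos ⟨Subsingleton.elim _ _, Subsingleton.elim _ _⟩, mul_one]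
  rfl

/-- The rearrangement `(B, C), (K, L) ↦ (K, B), (L, C)`. -/
def distributeEquiv (α γ ε ζ : Type) : (α ⊕ γ) ⊕ (ε ⊕ ζ) ≃ (ε ⊕ α) ⊕ (ζ ⊕ γ) :=
  (Equiv.sumComm _ _).trans (Equiv.sumSumSumComm _ _ _ _)

/-- In the experiment each party prepends its own key, whereas a circuit produces Alice's output and
both keys side by side. Only a permutation of wires separates the two. -/
theorem relabel_distributeEquiv {ε ζ : Type} (ρ : Op ε) (σ : Op ζ) (X : Op (α ⊕ γ)) :
    relabel (distributeEquiv α γ ε ζ) (tensorOp X (tensorOp ρ σ)) =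
      tensorMap (prepend ρ) (prepend σ) X := by
  ext y y'
  have h (z : Bits ((ε ⊕ α) ⊕ (ζ ⊕ γ))) : Sum.elim ((z ∘ Sum.inl) ∘ Sum.inr)
      ((z ∘ Sum.inr) ∘ Sum.inr) = (z ∘ distributeEquiv α γ ε ζ) ∘ Sum.inl := by
    ext (i | i) <;> rfl
  simp only [tensorMap, onLeft, onRight, prepend, tensorOp, relabel, LinearMap.comp_apply,
    LinearMap.coe_mk, AddHom.coe_mk, Matrix.of_apply, Sum.elim_comp_inl, Sum.elim_comp_inr, h]
  rw [mul_comm, mul_assoc, mul_left_comm]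
  rfl

theorem classicalState_eq_sum [Fintype (Bits α)] (p : PMF (Bits α)) :
    classicalState p = ∑ x, ((p x).toReal : ℂ) • ket x := by
  classical
  ext y y'
  simp only [classicalState, Matrix.diagonal_apply, Matrix.sum_apply, Matrix.smul_apply, ket_apply,
    smul_eq_mul, mul_ite, mul_one, mul_zero]
  by_cases h : y = y'
  · subst h
    simp
  · rw [if_neg h, Finset.sum_eq_zero]
    intro x _
    exact if_neg fun hx => h (hx.1.trans hx.2.symm)

theorem outcomeProb_map_sum {ι : Type} (s : Finset ι) (Φ : Op α →ₗ[ℂ] Op β) (a : ι → ℝ)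
    (ρ : ι → Op α) (x : Bits β) :
    outcomeProb (Φ (∑ i ∈ s, (a i : ℂ) • ρ i)) x = ∑ i ∈ s, a i * outcomeProb (Φ (ρ i)) x := by
  simp [outcomeProb, map_sum, Matrix.sum_apply, Complex.re_sum]

end Operators

/-! ### Maps that act classically -/

/-- `Φ` acts as `f` on basis states, and the diagonal of `Φ ρ` depends only on that of `ρ`. -/
structure IsClassical {α β : Type} (Φ : Op α →ₗ[ℂ] Op β) (f : Bits α → Bits β) : Prop where
  map_ket : ∀ x, Φ (ket x) = ket (f x)
  map_diag_zero : ∀ ρ, (∀ x, ρ x x = 0) → ∀ y, Φ ρ y y = 0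

namespace IsClassical

variable {α β γ δ : Type}

theorem congr {Φ : Op α →ₗ[ℂ] Op β} {f g : Bits α → Bits β} (h : IsClassical Φ f)
    (hfg : ∀ x, g x = f x) : IsClassical Φ g := funext hfg ▸ h

theorem comp {Φ : Op α →ₗ[ℂ] Op β} {Ψ : Op β →ₗ[ℂ] Op γ} {f : Bits α → Bits β}
    {g : Bits β → Bits γ} (hΨ : IsClassical Ψ g) (hΦ : IsClassical Φ f) :
    IsClassical (Ψ ∘ₗ Φ) (g ∘ f) where
  map_ket x := by simp [hΦ.map_ket, hΨ.map_ket]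
  map_diag_zero ρ h := hΨ.map_diag_zero _ (hΦ.map_diag_zero _ h)

theorem tensorMap {Φ : Op α →ₗ[ℂ] Op β} {Ψ : Op γ →ₗ[ℂ] Op δ} {f : Bits α → Bits β}
    {g : Bits γ → Bits δ} (hΦ : IsClassical Φ f) (hΨ : IsClassical Ψ g) :
    IsClassical (tensorMap Φ Ψ) fun x => Sum.elim (f (x ∘ Sum.inl)) (g (x ∘ Sum.inr)) where
  map_ket x := by
    conv_lhs => rw [← Sum.elim_comp_inl_inr x, ← tensorOp_ket, tensorMap_tensorOp,
      hΦ.map_ket, hΨ.map_ket, tensorOp_ket]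
  map_diag_zero ρ h y := by
    refine hΨ.map_diag_zero _ (fun c => ?_) _
    exact hΦ.map_diag_zero _ (fun a => h _) _

theorem relabel (e : α ≃ β) : IsClassical (relabel e) fun x => x ∘ e.symm where
  map_ket := relabel_ket e
  map_diag_zero _ h _ := h _

/-- Injectivity keeps coherences off the diagonal: two inputs with the same image would contribute
their off-diagonal entry to a diagonal entry of the output. -/
theorem conj_basisMatrix {k l : ℕ} {f : Bits (Fin k) → Bits (Fin l)} (hf : f.Injective) :
    IsClassical (conj (basisMatrix f)) f := by
  have key (ρ : Op (Fin k)) (y y' : Bits (Fin l)) : conj (basisMatrix f) ρ y y' =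
      ∑ x, ∑ x', if y' = f x then if y = f x' then ρ x' x else 0 else 0 := by
    simp [conj, basisMatrix, Matrix.mul_apply, apply_ite]
  constructor
  · intro x
    ext y y'
    rw [key, Finset.sum_eq_single x, Finset.sum_eq_single x]
    · simp only [ket_apply]
      by_cases h : y = f x <;> by_cases h' : y' = f x <;> simp [h, h']
    · intro b _ hb
      simp [ket_apply, hb]
    · simp
    · intro b _ hb
      simp [ket_apply, hb]
    · simp
  · intro ρ h y
    rw [key]
    refine Finset.sum_eq_zero fun x _ => Finset.sum_eq_zero fun x' _ => ?_
    split_ifs with h1 h2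
    · rw [hf (h2.symm.trans h1), h]
    · rfl
    · rfl

theorem traceOut : IsClassical traceOut fun _ => ![] where
  map_ket x := by
    ext y y'
    simp [Uncloneable.traceOut, Matrix.trace, ket_apply, Subsingleton.elim _ (![] : Bits (Fin 0))]
  map_diag_zero ρ h y := by simp [Uncloneable.traceOut, Matrix.trace, h]

/-- Replacing `ρ` by its diagonal part does not change the diagonal of `Φ ρ`, and on the diagonal
part `Φ` is just `f`. Hence a classical test can be applied to an arbitrary, possibly entangled,
state. -/
theorem apply_diag [Fintype (Bits α)] {Φ : Op α →ₗ[ℂ] Op β} {f : Bits α → Bits β}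
    (h : IsClassical Φ f) {x : Bits α} {y : Bits β} (hxy : ∀ x', f x' = y ↔ x' = x) (ρ : Op α) :
    Φ ρ y y = ρ x x := by
  classical
  have h0 : Φ (ρ - ∑ z, ρ z z • ket z) y y = 0 := by
    refine h.map_diag_zero _ (fun z => ?_) y
    simp [Matrix.sum_apply, ket_apply]
  rw [map_sub, Matrix.sub_apply, sub_eq_zero] at h0
  rw [h0, map_sum, Matrix.sum_apply, Finset.sum_eq_single x]
  · simp [h.map_ket, ket_apply, (hxy x).2 rfl]
  · intro b _ hb
    have : y ≠ f b := fun h => hb ((hxy b).1 h.symm)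
    simp [h.map_ket, ket_apply, this]
  · simp

end IsClassical

/-! ### Quantum simulation of Boolean circuits -/

namespace Circ

variable {G : ℕ → ℕ → Type} {α β : Type}

theorem finite (c : Circ G α β) : Finite α ∧ Finite β := by
  induction c with
  | wires h e => exact ⟨h, Finite.of_equiv _ e⟩
  | gate g => exact ⟨inferInstance, inferInstance⟩
  | seq c d hc hd => exact ⟨hc.1, hd.2⟩
  | par c d hc hd =>
    have := hc.1
    have := hc.2
    have := hd.1
    have := hd.2
    exact ⟨inferInstance, inferInstance⟩

/-- Every input wire ends in a gate or a counted bundle of wires. So polynomial circuit size already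
bounds the widths of keys, messages and registers. -/
theorem card_le_of_arity_le {N : ℕ} (hG : ∀ k l, G k l → k ≤ N) (hN : 1 ≤ N) (c : Circ G α β) :
    Nat.card α ≤ N * c.size := by
  induction c with
  | wires h e => exact Nat.le_mul_of_pos_left _ hN
  | gate g => simpa [size] using hG _ _ g
  | seq c d hc hd =>
    rw [size, Nat.mul_add]
    omega
  | par c d hc hd =>
    have := c.finite.1
    have := d.finite.1
    rw [Nat.card_sum, size, Nat.mul_add]
    omega

/-- The circuit that does nothing. -/
def id (G : ℕ → ℕ → Type) (α : Type) [h : Finite α] : Circ G α α := wires h (Equiv.refl α)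

theorem size_id [Finite α] : (id G α).size = Nat.card α := rfl

end Circ

theorem QCirc.card_le {α β : Type} (c : QCirc α β) : Nat.card α ≤ 3 * c.size :=
  c.card_le_of_arity_le (fun _ _ g => by cases g <;> omega) (by omega)

theorem CCirc.card_le {α β : Type} (c : CCirc α β) : Nat.card α ≤ 2 * c.size :=
  c.card_le_of_arity_le (fun _ _ g => by cases g <;> omega) (by omega)

theorem QCirc.eval_id {α : Type} [Finite α] : QCirc.eval (Circ.id QGate α) = LinearMap.id := rfl

namespace QCirc

open IsClassical

theorem isClassical_seq {α β γ : Type} {c : QCirc α β} {d : QCirc β γ} {f : Bits α → Bits β}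
    {g : Bits β → Bits γ} (hc : IsClassical (eval c) f) (hd : IsClassical (eval d) g) :
    IsClassical (eval (.seq c d)) (g ∘ f) := hd.comp hc

theorem isClassical_par {α β γ δ : Type} {c : QCirc α β} {d : QCirc γ δ} {f : Bits α → Bits β}
    {g : Bits γ → Bits δ} (hc : IsClassical (eval c) f) (hd : IsClassical (eval d) g) :
    IsClassical (eval (.par c d)) fun x => Sum.elim (f (x ∘ Sum.inl)) (g (x ∘ Sum.inr)) :=
  hc.tensorMap hd

theorem isClassical_wires {α β : Type} (h : Finite α) (e : α ≃ β) :
    IsClassical (eval (.wires h e)) fun x => x ∘ e.symm := IsClassical.relabel e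

theorem isClassical_not : IsClassical (eval (.gate .not)) fun x => ![!x 0] :=
  conj_basisMatrix (by decide)

theorem isClassical_cnot : IsClassical (eval (.gate .cnot)) fun x => ![x 0, xor (x 0) (x 1)] :=
  conj_basisMatrix (by decide)

theorem isClassical_toffoli :
    IsClassical (eval (.gate .toffoli)) fun x => ![x 0, x 1, xor (x 2) (x 0 && x 1)] :=
  conj_basisMatrix (by decide)

theorem isClassical_init : IsClassical (eval (.gate .init)) fun _ => ![false] :=
  conj_basisMatrix (by decide)

theorem isClassical_discard : IsClassical (eval (.gate .discard)) fun _ => ![] :=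
  IsClassical.traceOut

end QCirc

theorem CGate.exists_qCirc {k l : ℕ} (g : CGate k l) :
    ∃ q : QCirc (Fin k) (Fin l), q.size ≤ 20 ∧ IsClassical (QCirc.eval q) g.eval := by
  cases g with
  | const b =>
    cases b with
    | false => exact ⟨.gate .init, by simp [Circ.size], QCirc.isClassical_init⟩
    | true =>
      refine ⟨.seq (.gate .init) (.gate .not), by simp [Circ.size], ?_⟩
      exact QCirc.isClassical_seq QCirc.isClassical_init QCirc.isClassical_not
  | copy =>
    -- Controlled-not onto a fresh `|0⟩`. The split into `Fin 1 ⊕ Fin 0` supplies the empty input of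
    -- `init`.
    refine ⟨.seq (.seq (.wires inferInstance (finSumFinEquiv (m := 1) (n := 0)).symm)
      (.seq (.par (Circ.id _ _) (.gate .init))
        (.wires inferInstance (finSumFinEquiv (m := 1) (n := 1))))) (.gate .cnot),
      by simp [Circ.size, Circ.size_id], ?_⟩
    have := QCirc.isClassical_seq (QCirc.isClassical_seq
      (QCirc.isClassical_wires inferInstance (finSumFinEquiv (m := 1) (n := 0)).symm)
      (QCirc.isClassical_seq (QCirc.isClassical_par
        (QCirc.isClassical_wires (inferInstanceAs (Finite (Fin 1))) (Equiv.refl _))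
        QCirc.isClassical_init)
        (QCirc.isClassical_wires inferInstance (finSumFinEquiv (m := 1) (n := 1)))))
      QCirc.isClassical_cnot
    refine this.congr fun x => ?_
    revert x
    decide
  | nand =>
    -- Toffoli onto a fresh `|1⟩`, after which both controls are traced out. With the rewiring this
    -- is the largest of the simulated gates, and it fits in the bound 20.
    refine ⟨.seq (.seq (.seq (.wires inferInstance (finSumFinEquiv (m := 2) (n := 0)).symm)
      (.seq (.par (Circ.id _ _) (.seq (.gate .init) (.gate .not)))
        (.wires inferInstance (finSumFinEquiv (m := 2) (n := 1))))) (.gate .toffoli))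
      (.seq (.wires inferInstance
        (((finSumFinEquiv (m := 1) (n := 1)).sumCongr (Equiv.refl (Fin 1))).trans
          (finSumFinEquiv (m := 2) (n := 1))).symm)
        (.seq (.par (.par (.gate .discard) (.gate .discard)) (Circ.id _ _))
          (.wires inferInstance (Equiv.emptySum _ _)))),
      by simp [Circ.size, Circ.size_id], ?_⟩
    have := QCirc.isClassical_seq (QCirc.isClassical_seq (QCirc.isClassical_seq
      (QCirc.isClassical_wires inferInstance (finSumFinEquiv (m := 2) (n := 0)).symm)
      (QCirc.isClassical_seq (QCirc.isClassical_par
        (QCirc.isClassical_wires (inferInstanceAs (Finite (Fin 2))) (Equiv.refl _))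
        (QCirc.isClassical_seq QCirc.isClassical_init QCirc.isClassical_not))
        (QCirc.isClassical_wires inferInstance (finSumFinEquiv (m := 2) (n := 1)))))
      QCirc.isClassical_toffoli)
      (QCirc.isClassical_seq (QCirc.isClassical_wires inferInstance
        (((finSumFinEquiv (m := 1) (n := 1)).sumCongr (Equiv.refl (Fin 1))).trans
          (finSumFinEquiv (m := 2) (n := 1))).symm)
        (QCirc.isClassical_seq (QCirc.isClassical_par
          (QCirc.isClassical_par QCirc.isClassical_discard QCirc.isClassical_discard)
          (QCirc.isClassical_wires (inferInstanceAs (Finite (Fin 1))) (Equiv.refl _)))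
          (QCirc.isClassical_wires inferInstance (Equiv.emptySum _ _))))
    refine this.congr fun x => ?_
    revert x
    decide
  | discard => exact ⟨.gate .discard, by simp [Circ.size], QCirc.isClassical_discard⟩

/-- Boolean circuits can be simulated by quantum circuits. -/
theorem CCirc.exists_qCirc {α β : Type} (c : CCirc α β) :
    ∃ q : QCirc α β, q.size ≤ 20 * c.size ∧ IsClassical (QCirc.eval q) (CCirc.eval c) := by
  induction c with
  | wires h e => exact ⟨.wires h e, Nat.le_mul_of_pos_left _ (by omega), .relabel e⟩
  | gate g => simpa only [Circ.size, mul_one, CCirc.eval] using g.exists_qCirc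
  | seq c d hc hd =>
    obtain ⟨q, hq, hqc⟩ := hc
    obtain ⟨r, hr, hrd⟩ := hd
    exact ⟨.seq q r, by simp only [Circ.size]; omega, hrd.comp hqc⟩
  | par c d hc hd =>
    obtain ⟨q, hq, hqc⟩ := hc
    obtain ⟨r, hr, hrd⟩ := hd
    exact ⟨.par q r, by simp only [Circ.size]; omega, hqc.tensorMap hrd⟩

/-! ### Boolean circuits for constants, copying and equality tests -/

namespace CCirc

/-- The bound is quadratic because each added bit rewires the whole register, and plain wires count
towards the size. -/
theorem exists_const {n : ℕ} (x : Bits (Fin n)) :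
    ∃ c : CCirc Empty (Fin n), c.size ≤ 2 * n ^ 2 ∧ ∀ u, c.eval u = x := by
  induction n with
  | zero =>
    exact ⟨.wires inferInstance (Equiv.equivOfIsEmpty _ _), by simp [Circ.size],
      fun u => Subsingleton.elim _ _⟩
  | succ n ih =>
    obtain ⟨c, hc, hx⟩ := ih (x ∘ Fin.castAdd 1)
    refine ⟨.seq (.wires inferInstance (Equiv.equivOfIsEmpty Empty (Empty ⊕ Fin 0)))
      (.seq (.par c (.gate (.const (x (Fin.last n))))) (.wires inferInstance finSumFinEquiv)),
      ?_, fun u => ?_⟩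
    · simp [Circ.size]
      nlinarith
    · funext i
      refine Fin.lastCases ?_ (fun i => ?_) i
      · simp [eval, CGate.eval]
      · have := finSumFinEquiv_symm_apply_castAdd (n := 1) i
        simp [eval, CGate.eval, hx]
        rfl

theorem exists_copy (n : ℕ) :
    ∃ c : CCirc (Fin n) (Fin n ⊕ Fin n), c.size ≤ 6 * n ^ 2 ∧ ∀ x, c.eval x = Sum.elim x x := by
  induction n with
  | zero =>
    exact ⟨.wires inferInstance (Equiv.equivOfIsEmpty _ _), by simp [Circ.size],
      fun u => Subsingleton.elim _ _⟩
  | succ n ih =>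
    obtain ⟨c, hc, hx⟩ := ih
    refine ⟨.seq (.wires inferInstance (finSumFinEquiv (m := n) (n := 1)).symm)
      (.seq (.par c (.seq (.gate .copy) (.wires inferInstance (finSumFinEquiv (m := 1) (n := 1)).symm)))
        (.wires inferInstance ((Equiv.sumSumSumComm _ _ _ _).trans
          (finSumFinEquiv.sumCongr finSumFinEquiv)))), ?_, fun x => ?_⟩
    · have := c.finite.2
      simp [Circ.size]
      nlinarith
    · funext i
      rcases i with i | i
      all_goals
        refine Fin.lastCases ?_ (fun i => ?_) i
        · simp [eval, CGate.eval, hx]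
          rfl
        · have := finSumFinEquiv_symm_apply_castAdd (n := 1) i
          simp [eval, CGate.eval, hx]
          rfl

theorem exists_and : ∃ c : CCirc (Fin 1 ⊕ Fin 1) (Fin 1), c.size ≤ 5 ∧
    ∀ x, c.eval x = fun _ => x (.inl 0) && x (.inr 0) := by
  refine ⟨.seq (.wires inferInstance finSumFinEquiv)
    (.seq (.gate .nand) (.seq (.gate .copy) (.gate .nand))), by simp [Circ.size], fun x => ?_⟩
  funext i
  simp [eval, CGate.eval]
  rfl

theorem exists_eqBit (b : Bool) : ∃ c : CCirc (Fin 1) (Fin 1), c.size ≤ 2 ∧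
    ∀ x, c.eval x = fun _ => x 0 == b := by
  cases b with
  | true => exact ⟨Circ.id _ _, by simp [Circ.size_id], by decide⟩
  | false => exact ⟨.seq (.gate .copy) (.gate .nand), by simp [Circ.size], by decide⟩

theorem exists_eqTest {n : ℕ} (x : Bits (Fin n)) : ∃ c : CCirc (Fin n) (Fin 1),
    c.size ≤ 1 + 10 * n ^ 2 ∧ ∀ y, (c.eval y = fun _ => true) ↔ y = x := by
  induction n with
  | zero =>
    exact ⟨.gate (.const true), by simp [Circ.size], fun y => by
      simp [eval, CGate.eval, Subsingleton.elim y x]; decide⟩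
  | succ n ih =>
    obtain ⟨c, hc, hx⟩ := ih (x ∘ Fin.castSucc)
    obtain ⟨d, hd, hd'⟩ := exists_eqBit (x (Fin.last n))
    obtain ⟨a, ha, ha'⟩ := exists_and
    refine ⟨.seq (.wires inferInstance (finSumFinEquiv (m := n) (n := 1)).symm)
      (.seq (.par c d) a), ?_, fun y => ?_⟩
    · simp [Circ.size]
      nlinarith
    · have h0 : (c.eval ((y ∘ finSumFinEquiv) ∘ Sum.inl) 0 = true) ↔
          ∀ i : Fin n, y i.castSucc = x i.castSucc := by
        have h1 := hx ((y ∘ finSumFinEquiv) ∘ Sum.inl)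
        rw [funext_iff, funext_iff, Fin.forall_fin_one] at h1
        exact h1
      rw [funext_iff, funext_iff, Fin.forall_fin_one, Fin.forall_fin_succ', ← h0]
      simp [eval, ha', hd']
      exact fun _ => Iff.rfl

end CCirc

/-! ### Hardwired inputs -/

theorem QCirc.exists_prepare {α : Type} [Finite α] (x : Bits α) :
    ∃ p : QCirc Empty α, p.size ≤ 41 * Nat.card α ^ 2 ∧
      QCirc.eval p (ket Empty.elim) = ket x := by
  let e := Finite.equivFin α
  obtain ⟨c, hc, hx⟩ := CCirc.exists_const (x ∘ e.symm)
  obtain ⟨q, hq, hqc⟩ := c.exists_qCirc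
  refine ⟨.seq q (.wires inferInstance e.symm), ?_, ?_⟩
  -- 41 = 20 · 2 + 1: the simulated constant circuit, and one final relabelling of the wires.
  · have := Nat.le_self_pow two_ne_zero (Nat.card α)
    simp only [Circ.size, Nat.card_eq_fintype_card (α := Fin _), Fintype.card_fin]
    omega
  · simp only [QCirc.eval, LinearMap.comp_apply]
    rw [hqc.map_ket, hx, relabel_ket]
    congr 1
    funext i
    simp

theorem QCirc.exists_hardwire_left {α β γ : Type} (p : QCirc Empty α) (q : QCirc (α ⊕ β) γ) :
    ∃ q' : QCirc β γ, q'.size = p.size + q.size + 2 * Nat.card β ∧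
      ∀ ρ, QCirc.eval q' ρ = QCirc.eval q (tensorOp (QCirc.eval p (ket Empty.elim)) ρ) := by
  have := q.finite.1
  have : Finite β := Finite.of_injective (Sum.inr : β → α ⊕ β) Sum.inr_injective
  refine ⟨.seq (.wires inferInstance (Equiv.emptySum Empty β).symm)
    (.seq (.par p (Circ.id _ _)) q), ?_, fun ρ => ?_⟩
  · simp only [Circ.size, Circ.size_id]
    omega
  · simp only [QCirc.eval, LinearMap.comp_apply]
    rw [relabel_emptySum_symm, tensorMap_tensorOp, QCirc.eval_id, LinearMap.id_apply]

theorem QCirc.exists_hardwire_right {α β γ : Type} (p : QCirc Empty β) (q : QCirc (α ⊕ β) γ) :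
    ∃ q' : QCirc α γ, q'.size = p.size + q.size + 2 * Nat.card α ∧
      ∀ ρ, QCirc.eval q' ρ = QCirc.eval q (tensorOp ρ (QCirc.eval p (ket Empty.elim))) := by
  have := q.finite.1
  have : Finite α := Finite.of_injective (Sum.inl : α → α ⊕ β) Sum.inl_injective
  refine ⟨.seq (.wires inferInstance (Equiv.sumEmpty α Empty).symm)
    (.seq (.par (Circ.id _ _) p) q), ?_, fun ρ => ?_⟩
  · simp only [Circ.size, Circ.size_id]
    omega
  · simp only [QCirc.eval, LinearMap.comp_apply]
    rw [relabel_sumEmpty_symm, tensorMap_tensorOp, QCirc.eval_id, LinearMap.id_apply]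

/-- The key register of a circuit can be computed from another key by a Boolean circuit with
partly fixed input. -/
theorem QCirc.exists_derivedKey {c κ κ' r : ℕ} {B γ : Type}
    (F : CCirc ((Fin c ⊕ Fin κ') ⊕ Fin r) (Fin κ)) (q : QCirc (Fin κ ⊕ B) γ)
    (x : Bits (Fin c)) (z : Bits (Fin r)) :
    ∃ q' : QCirc (Fin κ' ⊕ B) γ, q'.size ≤ 400 * (F.size + q.size + 1) ^ 2 ∧
      ∀ k', QCirc.eval q' ∘ₗ prepend (ket k') =
        QCirc.eval q ∘ₗ prepend (ket (F.eval (Sum.elim (Sum.elim x k') z))) := by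
  have := q.finite.1
  have : Finite B := Finite.of_injective (Sum.inr : B → Fin κ ⊕ B) Sum.inr_injective
  obtain ⟨cx, hcx, hx⟩ := CCirc.exists_const x
  obtain ⟨cz, hcz, hz⟩ := CCirc.exists_const z
  let d : CCirc (Fin κ') (Fin κ) :=
    .seq (.wires inferInstance
      ((Equiv.emptySum Empty (Fin κ')).symm.trans (Equiv.sumEmpty _ Empty).symm))
      (.seq (.par (.par cx (Circ.id _ _)) cz) F)
  have hd (k' : Bits (Fin κ')) : d.eval k' = F.eval (Sum.elim (Sum.elim x k') z) := by
    simp only [d, CCirc.eval, hx, hz]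
    rfl
  obtain ⟨e, he, hed⟩ := d.exists_qCirc
  refine ⟨.seq (.par e (Circ.id _ _)) q, ?_, fun k' => ?_⟩
  · have hF := F.card_le
    have hq := q.card_le
    simp only [Nat.card_sum, Nat.card_eq_fintype_card (α := Fin _), Fintype.card_fin] at hF hq
    have hds : d.size = κ' + (cx.size + κ' + cz.size + F.size) := by
      simp [d, Circ.size, Circ.size_id]
    -- The hardwired strings are inputs of `F`, so their lengths are at most twice its size.
    have h1 : c ^ 2 ≤ (2 * F.size) ^ 2 := Nat.pow_le_pow_left (by omega) 2
    have h2 : r ^ 2 ≤ (2 * F.size) ^ 2 := Nat.pow_le_pow_left (by omega) 2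
    simp only [Circ.size, Circ.size_id]
    nlinarith [Nat.zero_le (F.size * q.size)]
  · refine LinearMap.ext fun ρ => ?_
    simp only [QCirc.eval, LinearMap.comp_apply, prepend, LinearMap.coe_mk, AddHom.coe_mk]
    rw [tensorMap_tensorOp, QCirc.eval_id, LinearMap.id_apply, hed.map_ket, hd]

/-! ### Expectations over finite distributions -/

/-- The expectation of `f` under `p`. -/
def expect {α : Type} [Fintype α] (p : PMF α) (f : α → ℝ) : ℝ := ∑ x, (p x).toReal * f x

section Expect

variable {α β : Type} [Fintype α] [Fintype β]

theorem sum_toReal_eq_one (p : PMF α) : ∑ x, (p x).toReal = 1 := by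
  rw [← ENNReal.toReal_sum fun x _ => p.apply_ne_top x, ← tsum_fintype (L := .unconditional _),
    p.tsum_coe, ENNReal.toReal_one]

theorem expect_pure (a : α) (f : α → ℝ) : expect (PMF.pure a) f = f a := by
  classical
  rw [expect, Finset.sum_eq_single a]
  · simp
  · intro b _ hb
    simp [hb]
  · simp

theorem expect_bind (p : PMF α) (q : α → PMF β) (f : β → ℝ) :
    expect (p.bind q) f = expect p fun x => expect (q x) f := by
  have h (y : β) : (p.bind q y).toReal = ∑ x, (p x).toReal * (q x y).toReal := by
    rw [PMF.bind_apply, tsum_fintype, ENNReal.toReal_sum]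
    · simp
    · exact fun x _ => ENNReal.mul_ne_top (p.apply_ne_top x) ((q x).apply_ne_top y)
  simp only [expect, h, Finset.sum_mul, Finset.mul_sum, mul_assoc]
  exact Finset.sum_comm

theorem expect_map (p : PMF α) (g : α → β) (f : β → ℝ) :
    expect (p.map g) f = expect p (f ∘ g) := by
  rw [PMF.map, expect_bind]
  simp only [Function.comp_apply, expect_pure]
  rfl

theorem expect_comm (p : PMF α) (q : PMF β) (f : α → β → ℝ) :
    expect p (fun x => expect q (f x)) = expect q fun y => expect p fun x => f x y := by
  simp only [expect, Finset.mul_sum]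
  rw [Finset.sum_comm]
  simp only [mul_left_comm]

theorem expect_le_expect (p : PMF α) {f g : α → ℝ} (h : ∀ x, f x ≤ g x) :
    expect p f ≤ expect p g :=
  Finset.sum_le_sum fun x _ => mul_le_mul_of_nonneg_left (h x) ENNReal.toReal_nonneg

theorem expect_add_const (p : PMF α) (f : α → ℝ) (a : ℝ) :
    expect p (fun x => f x + a) = expect p f + a := by
  simp [expect, mul_add, Finset.sum_add_distrib, ← Finset.sum_mul, sum_toReal_eq_one]

theorem expect_le (p : PMF α) {f : α → ℝ} {a : ℝ} (h : ∀ x, f x ≤ a) : expect p f ≤ a := by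
  have := expect_le_expect p (g := fun _ => 0 + a) (by simpa using h)
  rw [expect_add_const] at this
  simpa [expect] using this

theorem expect_uniform_bits {n : ℕ} (f : Bits (Fin n) → ℝ) :
    expect (PMF.uniformOfFintype (Bits (Fin n))) f = ∑ x, ((2 : ℝ) ^ n)⁻¹ * f x := by
  simp [expect]

theorem acceptProb_eq_expect {γ : Type} [Fintype (Bits γ)] (D : QCirc γ (Fin 1))
    (p : PMF (Bits γ)) :
    acceptProb D p = expect p fun x => outcomeProb (QCirc.eval D (ket x)) fun _ => true := by
  rw [acceptProb, classicalState_eq_sum, outcomeProb_map_sum]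
  rfl

end Expect

/-! ### Polynomially bounded functions -/

/-- `f` is bounded by a polynomial. -/
def PolyBounded (f : ℕ → ℕ) : Prop := ∃ p : Polynomial ℕ, ∀ l, f l ≤ p.eval l

namespace PolyBounded

variable {f g : ℕ → ℕ}

theorem mono (hg : PolyBounded g) (h : ∀ l, f l ≤ g l) : PolyBounded f :=
  hg.imp fun _ hp l => (h l).trans (hp l)

theorem const (n : ℕ) : PolyBounded fun _ => n := ⟨.C n, by simp⟩

theorem add (hf : PolyBounded f) (hg : PolyBounded g) : PolyBounded fun l => f l + g l := by
  obtain ⟨p, hp⟩ := hf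
  obtain ⟨q, hq⟩ := hg
  exact ⟨p + q, fun l => by simpa using add_le_add (hp l) (hq l)⟩

theorem mul (hf : PolyBounded f) (hg : PolyBounded g) : PolyBounded fun l => f l * g l := by
  obtain ⟨p, hp⟩ := hf
  obtain ⟨q, hq⟩ := hg
  exact ⟨p * q, fun l => by simpa using Nat.mul_le_mul (hp l) (hq l)⟩

/-- The common shape of the size bounds in the reduction: hardwiring costs at most quadratically. -/
theorem const_mul_succ_sq (hf : PolyBounded f) (n : ℕ) :
    PolyBounded fun l => n * (f l + 1) ^ 2 := by
  have h := hf.add (const 1)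
  exact ((const n).mul (h.mul h)).mono fun l => by rw [sq]

end PolyBounded

/-! ### The cloning experiment with a given ciphertext -/

/-- Probability that Bob and Charlie both output `m`, when Alice is given the classical string
`x` and the state `ρ`, and Bob and Charlie are given the key `k`. -/
def winProb {c κ n : ℕ} {R B C : Type} (alice : QCirc (Fin c ⊕ R) (B ⊕ C))
    (bob : QCirc (Fin κ ⊕ B) (Fin n)) (charlie : QCirc (Fin κ ⊕ C) (Fin n)) (ρ : Op R)
    (m : Bits (Fin n)) (x : Bits (Fin c)) (k : Bits (Fin κ)) : ℝ :=
  outcomeProb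
    (tensorMap (QCirc.eval bob ∘ₗ prepend (ket k)) (QCirc.eval charlie ∘ₗ prepend (ket k))
      (QCirc.eval alice (tensorOp (ket x) ρ)))
    (Sum.elim m m)

/-- Testing whether both output registers hold the string `m`. -/
theorem QCirc.exists_winTest {n : ℕ} (m : Bits (Fin n)) :
    ∃ q : QCirc (Fin n ⊕ Fin n) (Fin 1), q.size ≤ 140 + 400 * n ^ 2 ∧
      ∀ ρ, outcomeProb (QCirc.eval q ρ) (fun _ => true) = outcomeProb ρ (Sum.elim m m) := by
  obtain ⟨c, hc, hcm⟩ := CCirc.exists_eqTest m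
  obtain ⟨a, ha, hand⟩ := CCirc.exists_and
  obtain ⟨q, hq, hqc⟩ := CCirc.exists_qCirc (.seq (.par c c) a)
  refine ⟨q, ?_, fun ρ => ?_⟩
  -- Two equality tests and a conjunction, simulated at factor 20: 20 · (2 · (1 + 10n²) + 5).
  · simp only [Circ.size] at hq
    omega
  · unfold outcomeProb
    -- The test accepts exactly one basis string, so its acceptance probability is a single diagonal
    -- entry of `ρ`.
    rw [hqc.apply_diag (x := Sum.elim m m) (fun y => ?_)]
    rw [sumElim_eq_iff, ← hcm, ← hcm, funext_iff, funext_iff, funext_iff, Fin.forall_fin_one,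
      Fin.forall_fin_one, Fin.forall_fin_one]
    simp [CCirc.eval, hand]

/-- A circuit that runs the cloning experiment for a fixed message and a prepared state. -/
theorem QCirc.exists_cloningTest {c κ n : ℕ} {R B C : Type} (alice : QCirc (Fin c ⊕ R) (B ⊕ C))
    (bob : QCirc (Fin κ ⊕ B) (Fin n)) (charlie : QCirc (Fin κ ⊕ C) (Fin n)) (p : QCirc Empty R)
    (m : Bits (Fin n)) :
    ∃ D : QCirc (Fin c ⊕ Fin κ) (Fin 1),
      D.size ≤ 140 + 400 * n ^ 2 +
        1200 * (p.size + alice.size + bob.size + charlie.size + 1) ^ 2 ∧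
      ∀ x k, outcomeProb (QCirc.eval D (ket (Sum.elim x k))) (fun _ => true) =
        winProb alice bob charlie (QCirc.eval p (ket Empty.elim)) m x k := by
  have hA := alice.card_le
  have hB := bob.card_le
  have hC := charlie.card_le
  have := alice.finite.1
  have := alice.finite.2
  have : Finite R := Finite.of_injective (Sum.inr : R → Fin c ⊕ R) Sum.inr_injective
  have : Finite B := Finite.of_injective (Sum.inl : B → B ⊕ C) Sum.inl_injective
  have : Finite C := Finite.of_injective (Sum.inr : C → B ⊕ C) Sum.inr_injective
  obtain ⟨a, ha, hpa⟩ := QCirc.exists_hardwire_right p alice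
  obtain ⟨dup, hdup, hdupk⟩ := CCirc.exists_copy κ
  obtain ⟨d, hd, hddup⟩ := dup.exists_qCirc
  obtain ⟨t, ht, htm⟩ := QCirc.exists_winTest m
  refine ⟨.seq (.seq (.seq (.par a d) (.wires inferInstance (distributeEquiv _ _ _ _)))
    (.par bob charlie)) t, ?_, fun x k => ?_⟩
  · simp only [Nat.card_sum] at hA hB hC
    simp only [Circ.size, Nat.card_sum, Nat.card_eq_fintype_card (α := Fin _),
      Fintype.card_fin] at *
    -- Copying the key costs at most 20 · 6κ², and the key is part of Bob's input.
    have h1 : κ ^ 2 ≤ (3 * bob.size) ^ 2 := Nat.pow_le_pow_left (by omega) 2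
    nlinarith
  · rw [winProb, tensorMap_comp_prepend, ← relabel_distributeEquiv, ← tensorOp_ket]
    simp only [QCirc.eval, LinearMap.comp_apply]
    rw [htm, tensorMap_tensorOp, hpa, hddup.map_ket, hdupk, tensorOp_ket]

theorem QuantumEnc.cloneProb_eq_expect (S : QuantumEnc) (l : ℕ) {B C : Type}
    (alice : QCirc (S.ct l) (B ⊕ C)) (bob : QCirc (Fin (S.keyLen l) ⊕ B) (Fin (S.msgLen l)))
    (charlie : QCirc (Fin (S.keyLen l) ⊕ C) (Fin (S.msgLen l))) :
    S.cloneProb l alice bob charlie =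
      expect (PMF.uniformOfFintype (Bits (Fin (S.msgLen l)))) fun m =>
        expect (S.setup l) fun k =>
          outcomeProb
            (tensorMap (QCirc.eval bob ∘ₗ prepend (ket k)) (QCirc.eval charlie ∘ₗ prepend (ket k))
              (QCirc.eval alice (S.enc l k m)))
            (Sum.elim m m) := by
  rw [expect_uniform_bits]
  simp only [cloneProb, expect, Finset.mul_sum, mul_assoc]

/-! ### The distinguisher and the adversary of the reduction -/

section Reduction

variable (UE : QuantumEnc) (P : PrivKeyEnc UE.keyLen) (l : ℕ) {B C : Type}
  (alice : QCirc (Fin (P.ctLen l) ⊕ UE.ct l) (B ⊕ C))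
  (bob : QCirc (Fin (P.keyLen l) ⊕ B) (Fin (UE.msgLen l)))
  (charlie : QCirc (Fin (P.keyLen l) ⊕ C) (Fin (UE.msgLen l)))

theorem expect_realPair (k' : Bits (Fin (UE.keyLen l)))
    (f : Bits (Fin (P.ctLen l)) → Bits (Fin (P.keyLen l)) → ℝ) :
    expect (P.realPair l k') (fun y => f (y ∘ Sum.inl) (y ∘ Sum.inr)) =
      expect (P.setup l) fun k => expect (P.enc l k k') fun x => f x k := by
  simp only [PrivKeyEnc.realPair, expect_bind, expect_pure, Sum.elim_comp_inl, Sum.elim_comp_inr]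

theorem expect_fakePair
    (fakeGen : ∀ l, Bits (Fin (P.ctLen l)) → Bits (Fin (UE.keyLen l)) →
      PMF (Bits (Fin (P.keyLen l))))
    (k' : Bits (Fin (UE.keyLen l))) (f : Bits (Fin (P.ctLen l)) → Bits (Fin (P.keyLen l)) → ℝ) :
    expect (P.fakePair fakeGen l k') (fun y => f (y ∘ Sum.inl) (y ∘ Sum.inr)) =
      expect (P.setup l) fun k => expect (P.enc l k fun _ => false) fun x =>
        expect (fakeGen l x k') fun k => f x k := by
  simp only [PrivKeyEnc.fakePair, expect_bind, expect_pure, Sum.elim_comp_inl, Sum.elim_comp_inr]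

/-- The cloning experiment against the reusable scheme, with the key of the underlying scheme
sampled first. -/
theorem cloneProb_reusableScheme :
    (reusableScheme UE P).cloneProb l alice bob charlie =
      expect (PMF.uniformOfFintype (Bits (Fin (UE.msgLen l)))) fun m =>
        expect (UE.setup l) fun k' => expect (P.realPair l k') fun y =>
          winProb alice bob charlie (UE.enc l k' m) m (y ∘ Sum.inl) (y ∘ Sum.inr) := by
  refine (QuantumEnc.cloneProb_eq_expect _ _ _ _ _).trans ?_
  change expect (PMF.uniformOfFintype (Bits (Fin (UE.msgLen l)))) _ = _
  congr 1
  funext m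
  have h (k' : Bits (Fin (UE.keyLen l))) := expect_realPair UE P l k'
    fun x k => winProb alice bob charlie (UE.enc l k' m) m x k
  simp only [h]
  -- The two keys are drawn independently, so either may be sampled first.
  rw [expect_comm]
  change expect (P.setup l) _ = _
  congr 1
  funext k
  let Φ := tensorMap (QCirc.eval bob ∘ₗ prepend (ket k)) (QCirc.eval charlie ∘ₗ prepend (ket k))
    ∘ₗ QCirc.eval alice
  change outcomeProb (Φ (∑ k', ((UE.setup l k').toReal : ℂ) •
    tensorOp (classicalState (P.enc l k k')) (UE.enc l k' m))) (Sum.elim m m) = _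
  rw [outcomeProb_map_sum, expect]
  refine Finset.sum_congr rfl fun k' _ => ?_
  simp only [classicalState_eq_sum, tensorOp_sum_left, tensorOp_smul_left, outcomeProb_map_sum]
  rfl

/-- The adversary against the underlying scheme that is given by a fixed first ciphertext `x`
and fixed coins `z` for the generation of the fake key. -/
theorem exists_adversary {r : ℕ}
    (F : CCirc ((Fin (P.ctLen l) ⊕ Fin (UE.keyLen l)) ⊕ Fin r) (Fin (P.keyLen l)))
    (x : Bits (Fin (P.ctLen l))) (z : Bits (Fin r)) :
    ∃ (alice' : QCirc (UE.ct l) (B ⊕ C))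
      (bob' : QCirc (Fin (UE.keyLen l) ⊕ B) (Fin (UE.msgLen l)))
      (charlie' : QCirc (Fin (UE.keyLen l) ⊕ C) (Fin (UE.msgLen l))),
      alice'.size ≤ 400 * (alice.size + 1) ^ 2 ∧
      bob'.size ≤ 400 * (F.size + bob.size + 1) ^ 2 ∧
      charlie'.size ≤ 400 * (F.size + charlie.size + 1) ^ 2 ∧
      UE.cloneProb l alice' bob' charlie' =
        expect (PMF.uniformOfFintype (Bits (Fin (UE.msgLen l)))) fun m =>
          expect (UE.setup l) fun k' =>
            winProb alice bob charlie (UE.enc l k' m) m x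
              (F.eval (Sum.elim (Sum.elim x k') z)) := by
  obtain ⟨p, hp, hpx⟩ := QCirc.exists_prepare x
  obtain ⟨alice', ha, hpa⟩ := QCirc.exists_hardwire_left p alice
  obtain ⟨bob', hb, hbF⟩ := QCirc.exists_derivedKey F bob x z
  obtain ⟨charlie', hc, hcF⟩ := QCirc.exists_derivedKey F charlie x z
  refine ⟨alice', bob', charlie', ?_, hb, hc, ?_⟩
  · have := UE.ctFinite l
    have hA := alice.card_le
    simp only [Nat.card_sum, Nat.card_eq_fintype_card (α := Fin _), Fintype.card_fin] at hA hp
    -- The hardwired ciphertext is part of Alice's input; 41 · 9 plus linear terms stays below 400.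
    have h1 : P.ctLen l ^ 2 ≤ (3 * alice.size) ^ 2 := Nat.pow_le_pow_left (by omega) 2
    nlinarith
  · simp only [QuantumEnc.cloneProb_eq_expect, hpa, hbF, hcF, hpx]
    rfl

/-- The distinguisher that runs the cloning experiment for a fixed message `m` and a fixed key
`k'` of the underlying scheme. -/
theorem exists_distinguisher
    (enc : QCirc (Fin (UE.keyLen l) ⊕ Fin (UE.msgLen l)) (UE.ct l))
    (henc : ∀ k m, QCirc.eval enc (ket (Sum.elim k m)) = UE.enc l k m)
    (k' : Bits (Fin (UE.keyLen l))) (m : Bits (Fin (UE.msgLen l))) :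
    ∃ D : QCirc (Fin (P.ctLen l) ⊕ Fin (P.keyLen l)) (Fin 1),
      D.size ≤ 4000 * (enc.size + 1) ^ 2 + 1200 *
        (400 * (enc.size + 1) ^ 2 + alice.size + bob.size + charlie.size + 1) ^ 2 ∧
      ∀ p, acceptProb D p = expect p fun y =>
        winProb alice bob charlie (UE.enc l k' m) m (y ∘ Sum.inl) (y ∘ Sum.inr) := by
  obtain ⟨p, hp, hpk⟩ := QCirc.exists_prepare (Sum.elim k' m)
  obtain ⟨D, hD, hDw⟩ := QCirc.exists_cloningTest alice bob charlie (.seq p enc) m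
  refine ⟨D, hD.trans ?_, fun q => ?_⟩
  · have hcard := enc.card_le
    have h1 : Nat.card (Fin (UE.keyLen l) ⊕ Fin (UE.msgLen l)) ^ 2 ≤ (3 * enc.size) ^ 2 :=
      Nat.pow_le_pow_left hcard 2
    simp only [Nat.card_sum, Nat.card_eq_fintype_card (α := Fin _), Fintype.card_fin] at hcard
    have h2 : UE.msgLen l ^ 2 ≤ (3 * enc.size) ^ 2 := Nat.pow_le_pow_left (by omega) 2
    refine add_le_add (by nlinarith) (Nat.mul_le_mul_left _ (Nat.pow_le_pow_left ?_ 2))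
    simp only [Circ.size]
    nlinarith
  · rw [acceptProb_eq_expect]
    congr 1
    funext y
    conv_lhs => rw [← Sum.elim_comp_inl_inr y]
    rw [hDw]
    simp only [QCirc.eval, LinearMap.comp_apply, hpk, henc]

end Reduction

end Uncloneable

end

/-! ### The hybrid step and the averaging argument -/

open Uncloneable in
theorem theorem4 (UE : Uncloneable.QuantumEnc) (hUE : UE.Efficient)
    (P : Uncloneable.PrivKeyEnc UE.keyLen) (hP : P.Efficient) (hfk : P.FakeKeyProperty)
    (t : ℕ → ℝ) (ht : UE.UncloneableSecure t) :
    (Uncloneable.reusableScheme UE P).UncloneableSecure t := by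
  intro B C alice bob charlie hA hB hC
  obtain ⟨-, ⟨enc, hencS, henc⟩, -⟩ := hUE
  obtain ⟨fakeGen, ⟨r, F, hF, hFG⟩, hind⟩ := hfk
  -- The distinguisher for the key and message with the largest gap.
  choose D hDS hD using fun l => exists_distinguisher UE P l (alice l) (bob l) (charlie l)
    (enc l) (henc l)
  let gap (l : ℕ) (km : Bits (Fin (UE.keyLen l)) × Bits (Fin (UE.msgLen l))) : ℝ :=
    |acceptProb (D l km.1 km.2) (P.realPair l km.1) -
      acceptProb (D l km.1 km.2) (P.fakePair fakeGen l km.1)|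
  choose km hkm using fun l => Finite.exists_max (gap l)
  have hgap : Negligible fun l => gap l (km l) := by
    refine hind (fun l => (km l).1) (fun l => D l (km l).1 (km l).2) ?_
    have hs : PolyBounded fun l => 400 * ((enc l).size + 1) ^ 2 + (alice l).size +
        (bob l).size + (charlie l).size :=
      (((PolyBounded.const_mul_succ_sq hencS 400).add hA).add hB).add hC
    exact ((PolyBounded.const_mul_succ_sq hencS 4000).add (hs.const_mul_succ_sq 1200)).mono
      fun l => hDS l (km l).1 (km l).2
  -- The adversary for the ciphertext and coins with the largest success probability.
  choose a b c ha hb hc hwin using fun l (xz : Bits (Fin (P.ctLen l)) × Bits (Fin (r l))) =>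
    exists_adversary UE P l (alice l) (bob l) (charlie l) (F l) xz.1 xz.2
  choose xz hxz using fun l => Finite.exists_max fun xz => UE.cloneProb l (a l xz) (b l xz) (c l xz)
  obtain ⟨ν, hν, hbound⟩ := ht B C (fun l => a l (xz l)) (fun l => b l (xz l))
    (fun l => c l (xz l))
    ((PolyBounded.const_mul_succ_sq hA 400).mono fun l => ha l (xz l))
    ((PolyBounded.const_mul_succ_sq (PolyBounded.add hF hB) 400).mono fun l => hb l (xz l))
    ((PolyBounded.const_mul_succ_sq (PolyBounded.add hF hC) 400).mono fun l => hc l (xz l))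
  refine ⟨fun l => ν l + gap l (km l), hν.add hgap, fun l => ?_⟩
  let win (m : Bits (Fin (UE.msgLen l))) (k' : Bits (Fin (UE.keyLen l)))
      (x : Bits (Fin (P.ctLen l))) (k : Bits (Fin (P.keyLen l))) : ℝ :=
    winProb (alice l) (bob l) (charlie l) (UE.enc l k' m) m x k
  have hreal : (reusableScheme UE P).cloneProb l (alice l) (bob l) (charlie l) ≤
      (expect (PMF.uniformOfFintype _) fun m => expect (UE.setup l) fun k' =>
        expect (P.fakePair fakeGen l k') fun y => win m k' (y ∘ Sum.inl) (y ∘ Sum.inr)) +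
        gap l (km l) := by
    refine (cloneProb_reusableScheme UE P l (alice l) (bob l) (charlie l)).trans_le ?_
    rw [← expect_add_const]
    refine expect_le_expect _ fun m => ?_
    rw [← expect_add_const]
    refine expect_le_expect _ fun k' => ?_
    -- Maximality of `km l` makes one gap serve for every key and message.
    have h := (le_abs_self _).trans (hkm l (k', m))
    rw [hD, hD] at h
    exact sub_le_iff_le_add'.1 h
  have hfake : (expect (PMF.uniformOfFintype _) fun m => expect (UE.setup l) fun k' =>
        expect (P.fakePair fakeGen l k') fun y => win m k' (y ∘ Sum.inl) (y ∘ Sum.inr)) ≤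
      UE.cloneProb l (a l (xz l)) (b l (xz l)) (c l (xz l)) := by
    have hsplit (m : Bits (Fin (UE.msgLen l))) (k' : Bits (Fin (UE.keyLen l))) :
        (expect (P.fakePair fakeGen l k') fun y => win m k' (y ∘ Sum.inl) (y ∘ Sum.inr)) =
          expect (P.setup l) fun k => expect (P.enc l k fun _ => false) fun x =>
            expect (PMF.uniformOfFintype (Bits (Fin (r l)))) fun z =>
              win m k' x ((F l).eval (Sum.elim (Sum.elim x k') z)) := by
      rw [expect_fakePair]
      congr! 5 with k x
      have := hFG l (Sum.elim x k')
      simp only [Sum.elim_comp_inl, Sum.elim_comp_inr] at this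
      rw [this, expect_map]
      rfl
    -- The ciphertext and coins are independent of `m` and `k'`, so their expectations move
    -- outermost and are then bounded by the best fixed choice.
    simp only [hsplit]
    simp only [expect_comm (UE.setup l)]
    simp only [expect_comm (PMF.uniformOfFintype (Bits (Fin (UE.msgLen l))))]
    refine expect_le _ fun k => expect_le _ fun x => expect_le _ fun z => ?_
    -- Moving `m` inwards also carried it past `k'`; this restores the order of the experiment.
    rw [expect_comm]
    exact (hwin l (x, z)).symm.trans_le (hxz l (x, z))
  have := hbound l
  have hn : (reusableScheme UE P).msgLen l = UE.msgLen l := rfl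
  rw [hn]
  linarith
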